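/- All graphs are finite and simple (the empty graph is allowed). For graphs $G,H$ let $\mathbf{Col}(G,H)$ be the graph whose vertices are the homomorphisms $G\to H$, two distinct homomorphisms being adjacent if they differ on exactly one vertex of $G$; $G$ is $H$-mixing if $\mathbf{Col}(G,H)$ is connected (in particular non-empty). For positive integers $p,q$ with $p/q\ge 2$, the circular clique $G_{p,q}$ has vertex set $\{0,\dots,p-1\}$, with $u,v$ adjacent if and only if $q\le |u-v|\le p-q$. The circular mixing number of $G$ is $$m_c(G)=\inf\Big\{\tfrac pq \;:\; p,q\in\mathbb{Z}^{+},\ \tfrac pq\ge 2,\ G\text{ is }G_{p,q}\text{-mixing}\Big\}.$$ Let $\omega(G)$ be the clique number of $G$ and $C_n$ the cycle on $n$ vertices. **Theorem.** Let $G$ be a finite simple graph. 1. If $G$ is bipartite, then: (a) there is an integer $k\ge 1$ such that $G$ is $C_{2k+1}$-mixing; (b) there is $k_0$ such that $G$ is $C_{2k+1}$-mixing for every $k\ge k_0$; more precisely, $G$ is $C_{2k+1}$-mixing for every integer $k\ge 1$ such that every cycle of $G$ has length less than $4k+2$; (c) $m_c(G)=2$. 2. If $G$ is not bipartite, then $m_c(G)\ge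 \max\{4,\ \omega(G)+1\}$. -/

import Mathlib

/-- The reconfiguration graph `Col(G, H)`: its vertices are the homomorphisms `G → H`, and two
distinct homomorphisms are adjacent when they differ on at most one vertex of `G`.
(The loops are dropped; they do not affect connectedness.) -/
def colGraph {V W : Type*} (G : SimpleGraph V) (H : SimpleGraph W) : SimpleGraph (G →g H) where
  Adj f g := f ≠ g ∧ {v : V | f v ≠ g v}.Subsingleton
  symm := ⟨fun _ _ h => ⟨h.1.symm, fun _ hx _ hy => h.2 (Ne.symm hx) (Ne.symm hy)⟩⟩
  loopless := ⟨fun _ h => h.1 rfl⟩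

/-- `G` is `H`-mixing when `Col(G, H)` is connected. A connected graph has at least one vertex,
so `G` has to admit an `H`-colouring. -/
def IsMixing {V W : Type*} (G : SimpleGraph V) (H : SimpleGraph W) : Prop :=
  (colGraph G H).Connected

/-- The circular clique `G_{p,q}`: vertices `0, …, p - 1`, with `u` adjacent to `v` if and only if
`q ≤ |u - v| ≤ p - q`. (For positive `q`, the case in use, the condition `u ≠ v` is automatic.) -/
def circularClique (p q : ℕ) : SimpleGraph (Fin p) where
  Adj u v := u ≠ v ∧ (q : ℤ) ≤ |(u : ℤ) - (v : ℤ)| ∧ |(u : ℤ) - (v : ℤ)| ≤ (p : ℤ) - (q : ℤ)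
  symm := ⟨fun u v h => by rw [abs_sub_comm]; exact ⟨h.1.symm, h.2⟩⟩
  loopless := ⟨fun _ h => h.1 rfl⟩

/-- The circular mixing number of `G`: the infimum of `p / q` over all positive integers `p, q`
with `p / q ≥ 2` such that `G` is `G_{p,q}`-mixing. -/
noncomputable def circularMixingNumber {V : Type*} (G : SimpleGraph V) : ℝ :=
  sInf {r : ℝ | ∃ p q : ℕ, 0 < q ∧ 2 * q ≤ p ∧ IsMixing G (circularClique p q) ∧
    r = (p : ℝ) / (q : ℝ)}

/-! For odd `n`, the bipartite double cover of the cycle `C_n` is `C_{2n}`, so a `C_n`-colouring of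
a bipartite graph is a `C_{2n}`-colouring, which lifts to a height function `V → ℤ` as soon as all
cycles are shorter than `2n`. Two height functions of the same parity are joined by lowering
local maxima. Since `C_{2k+1}` is `G_{2k+1,k}` and `(2k+1)/k → 2`, this also gives the value of
`m_c`.

For the lower bounds, view the vertices of `G_{p,q}` as points on a circle. Recolouring a vertex
from `a` to `b` preserves the winding numbers of all closed walks unless its neighbours lie on both
arcs between `a` and `b`. This requires `4q ≤ p` and `a` adjacent to `b`; inside a clique `K_m` the
colour `b` then extends the colouring to one of `K_{m+1}`, so that `(m+1)q ≤ p`. On the other hand a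
colouring and its reflection have opposite winding numbers, and if they can be joined without
changing winding numbers then the graph is bipartite.
-/

section Reconfiguration

variable {V V' W W' : Type*} {G : SimpleGraph V} {G' : SimpleGraph V'} {H : SimpleGraph W}
  {H' : SimpleGraph W'}

theorem colGraph_reachable_of_eq_off {f g : G →g H} (v : V) (hfg : ∀ w, w ≠ v → f w = g w) :
    (colGraph G H).Reachable f g := by
  have hv : ∀ w, f w ≠ g w → w = v := fun w hw => not_not.1 (mt (hfg w) hw)
  by_cases h : f = g
  · exact h ▸ .rfl
  · exact SimpleGraph.Adj.reachable ⟨h, fun x hx y hy => (hv x hx).trans (hv y hy).symm⟩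

theorem exists_eq_off_of_colGraph_adj {f g : G →g H} (h : (colGraph G H).Adj f g) :
    ∃ v, ∀ w, w ≠ v → f w = g w := by
  obtain ⟨v, hv⟩ := DFunLike.ne_iff.1 h.1
  exact ⟨v, fun w hw => not_not.1 fun hfg => hw (h.2 hfg hv)⟩

theorem rel_of_colGraph_reachable {r : (G →g H) → (G →g H) → Prop} (refl : ∀ f, r f f)
    (trans : ∀ f g h, r f g → r g h → r f h)
    (step : ∀ f g (v : V), (∀ w, w ≠ v → f w = g w) → r f g) {f g : G →g H}
    (h : (colGraph G H).Reachable f g) : r f g := by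
  obtain ⟨p⟩ := h
  induction p with
  | nil => exact refl _
  | cons hadj _ ih =>
    obtain ⟨v, hv⟩ := exists_eq_off_of_colGraph_adj hadj
    exact trans _ _ _ (step _ _ v hv) ih

theorem colGraph_reachable_comp_left (φ : H →g H') {f g : G →g H}
    (h : (colGraph G H).Reachable f g) : (colGraph G H').Reachable (φ.comp f) (φ.comp g) :=
  rel_of_colGraph_reachable (r := fun f g => (colGraph G H').Reachable (φ.comp f) (φ.comp g))
    (fun _ => .rfl) (fun _ _ _ => .trans)
    (fun _ _ v hv => colGraph_reachable_of_eq_off v fun w hw => congrArg φ (hv w hw)) h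

theorem colGraph_reachable_comp_right (φ : G' ↪g G) {f g : G →g H}
    (h : (colGraph G H).Reachable f g) :
    (colGraph G' H).Reachable (f.comp φ.toHom) (g.comp φ.toHom) := by
  refine rel_of_colGraph_reachable
    (r := fun f g => (colGraph G' H).Reachable (f.comp φ.toHom) (g.comp φ.toHom))
    (fun _ => .rfl) (fun _ _ _ => .trans) (fun f g v hv => ?_) h
  by_cases hrange : ∃ v', φ v' = v
  · obtain ⟨v', rfl⟩ := hrange
    exact colGraph_reachable_of_eq_off v' fun w hw => hv _ (φ.injective.ne hw)
  · have heq : f.comp φ.toHom = g.comp φ.toHom :=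
      RelHom.ext fun w => hv _ fun hw => hrange ⟨w, hw⟩
    exact heq ▸ .rfl

theorem isMixing_of_iso (e : H ≃g H') (h : IsMixing G H) : IsMixing G H' := by
  have hcomp : ∀ f : G →g H', e.toHom.comp (e.symm.toHom.comp f) = f := fun f =>
    RelHom.ext fun v => e.apply_symm_apply (f v)
  have : Nonempty (G →g H') := h.nonempty.map e.toHom.comp
  refine ⟨fun f g => ?_⟩
  rw [← hcomp f, ← hcomp g]
  exact colGraph_reachable_comp_left _ (h.preconnected _ _)

/-- The homomorphism obtained from `f` by giving the single vertex `v` the colour `c`. -/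
def recolor [DecidableEq V] (f : G →g H) (v : V) (c : W)
    (hc : ∀ u, G.Adj v u → H.Adj c (f u)) : G →g H where
  toFun := Function.update f v c
  map_rel' {x y} hxy := by
    rcases eq_or_ne x v with rfl | hx
    · simpa [hxy.ne'] using hc y hxy
    rcases eq_or_ne y v with rfl | hy
    · simpa [hx] using (hc x hxy.symm).symm
    · simpa [hx, hy] using f.map_adj hxy

theorem recolor_self [DecidableEq V] (f : G →g H) (v : V) (c : W)
    (hc : ∀ u, G.Adj v u → H.Adj c (f u)) : recolor f v c hc v = c := by
  simp [recolor]

theorem recolor_of_ne [DecidableEq V] (f : G →g H) {v w : V} (c : W)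
    (hc : ∀ u, G.Adj v u → H.Adj c (f u)) (hw : w ≠ v) : recolor f v c hc w = f w := by
  simp [recolor, hw]

theorem colGraph_reachable_recolor [DecidableEq V] (f : G →g H) (v : V) (c : W)
    (hc : ∀ u, G.Adj v u → H.Adj c (f u)) : (colGraph G H).Reachable f (recolor f v c hc) :=
  colGraph_reachable_of_eq_off v fun _ hw => (recolor_of_ne f c hc hw).symm

theorem colGraph_reachable_of_forall_adj [Finite V] {f g : G →g H}
    (hfg : ∀ u v, G.Adj u v → H.Adj (f u) (g v)) : (colGraph G H).Reachable f g := by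
  classical
  have := Fintype.ofFinite V
  let mix (A : Finset V) : G →g H :=
    ⟨A.piecewise g f, fun {u v} huv => by
      by_cases hu : u ∈ A <;> by_cases hv : v ∈ A <;> simp only [hu, hv, Finset.piecewise,
        if_true, if_false]
      exacts [g.map_adj huv, (hfg v u huv.symm).symm, hfg u v huv, f.map_adj huv]⟩
  have hmix (A : Finset V) : (colGraph G H).Reachable (mix ∅) (mix A) := by
    induction A using Finset.induction_on with
    | empty => exact .rfl
    | insert a A _ ih =>
      refine ih.trans (colGraph_reachable_of_eq_off a fun w hw => ?_)
      by_cases hwA : w ∈ A <;> simp [mix, Finset.piecewise, hw, hwA]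
  have hempty : mix ∅ = f := RelHom.ext fun v => congrFun (Finset.piecewise_empty g f) v
  have huniv : mix Finset.univ = g := RelHom.ext fun v => congrFun (Finset.piecewise_univ g f) v
  exact hempty ▸ huniv ▸ hmix Finset.univ

end Reconfiguration

section UnitStep

variable {V R S : Type*} {G : SimpleGraph V}

/-- The Cayley graph of the additive group of `R` with generator `1`: the two-way infinite path
for `ℤ`, and the cycle of length `n` for `ZMod n`. Homomorphisms to `unitStepGraph ℤ` are the
height functions on a graph. -/
def unitStepGraph (R : Type*) [Ring R] : SimpleGraph R := SimpleGraph.circulantGraph {1}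

theorem unitStepGraph_adj [Ring R] [Nontrivial R] {x y : R} :
    (unitStepGraph R).Adj x y ↔ x - y = 1 ∨ y - x = 1 := by
  simp only [unitStepGraph, SimpleGraph.circulantGraph_adj, Set.mem_singleton_iff,
    and_iff_right_iff_imp]
  rintro h rfl
  simp at h

/-- The homomorphism of unit step graphs induced by a ring homomorphism. -/
def unitStepMap [Ring R] [Ring S] [Nontrivial S] (φ : R →+* S) :
    unitStepGraph R →g unitStepGraph S where
  toFun := φ
  map_rel' {x y} h := by
    have := φ.domain_nontrivial
    rw [unitStepGraph_adj] at h ⊢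
    simp only [← map_sub]
    exact h.imp (fun h => by rw [h, map_one]) fun h => by rw [h, map_one]

theorem isBipartite_iff_nonempty_height :
    G.IsBipartite ↔ Nonempty (G →g unitStepGraph ℤ) := by
  constructor
  · rintro ⟨C⟩
    refine ⟨⟨fun v => ((C v : ℕ) : ℤ), fun {u v} huv => unitStepGraph_adj.2 ?_⟩⟩
    have := Fin.val_ne_of_ne (C.valid huv)
    omega
  · rintro ⟨F⟩
    refine (SimpleGraph.Coloring.mk (fun v => (F v : ZMod 2)) fun {u v} huv h => ?_ :
      G.Coloring (ZMod 2)).colorable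
    have := unitStepGraph_adj.1 (F.map_adj huv)
    rw [ZMod.intCast_eq_intCast_iff, Int.ModEq] at h
    omega

end UnitStep

section Lifting

variable {V : Type*} {G : SimpleGraph V} {N : ℕ}

theorem height_abs_sub_le_length (F : G →g unitStepGraph ℤ) {u v : V} (p : G.Walk u v) :
    |F u - F v| ≤ p.length := by
  induction p with
  | nil => simp
  | cons h p ih =>
    have := unitStepGraph_adj.1 (F.map_adj h)
    rw [SimpleGraph.Walk.length_cons]
    push_cast
    rw [abs_le] at ih ⊢
    omega

/-- Adds a constant on each connected component to a height function. -/
def shiftComponents (F : G →g unitStepGraph ℤ) (c : G.ConnectedComponent → ℤ) :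
    G →g unitStepGraph ℤ where
  toFun v := F v + c (G.connectedComponentMk v)
  map_rel' {u v} huv := by
    have := F.map_adj huv
    rw [SimpleGraph.ConnectedComponent.eq.2 huv.reachable]
    rw [unitStepGraph_adj] at this ⊢
    simpa only [add_sub_add_right_eq_sub] using this

theorem exists_shift_adj_of_cast_adj {x y : ℤ} (h : (unitStepGraph (ZMod N)).Adj x y) :
    ∃ d : ℤ, (N : ℤ) ∣ d ∧ (unitStepGraph ℤ).Adj x (y + d) := by
  simp only [unitStepGraph, SimpleGraph.circulantGraph_adj, Set.mem_singleton_iff] at h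
  rcases h.2 with h | h
  · refine ⟨x - y - 1, ?_, unitStepGraph_adj.2 (by omega)⟩
    rw [← ZMod.intCast_zmod_eq_zero_iff_dvd]
    push_cast
    rw [h, sub_self]
  · refine ⟨x - y + 1, ?_, unitStepGraph_adj.2 (by omega)⟩
    rw [← ZMod.intCast_zmod_eq_zero_iff_dvd]
    push_cast
    rw [← h]
    ring

theorem adj_of_cast_adj {x y : ℤ} (h : (unitStepGraph (ZMod N)).Adj x y)
    (hlt : |x - y| + 1 < N) : (unitStepGraph ℤ).Adj x y := by
  obtain ⟨d, hd, hadj⟩ := exists_shift_adj_of_cast_adj h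
  have hd0 : d = 0 := by
    refine Int.eq_zero_of_abs_lt_dvd hd (lt_of_le_of_lt ?_ hlt)
    rw [unitStepGraph_adj] at hadj
    grind
  simpa [hd0] using hadj

theorem abs_sub_add_one_lt_of_reachable {H : SimpleGraph V} (hHG : H ≤ G)
    (hcyc : ∀ (v : V) (c : G.Walk v v), c.IsCycle → c.length < N) (F : H →g unitStepGraph ℤ)
    {a b : V} (hab : G.Adj a b) (hnab : ¬ H.Adj a b) (hr : H.Reachable b a) :
    |F a - F b| + 1 < N := by
  obtain ⟨p, hp⟩ := hr.exists_isPath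
  have hcycle : (SimpleGraph.Walk.cons hab (p.mapLe hHG)).IsCycle := by
    rw [SimpleGraph.Walk.cons_isCycle_iff, SimpleGraph.Walk.edges_mapLe_eq_edges]
    exact ⟨hp.mapLe hHG, fun h => hnab (p.adj_of_mem_edges h)⟩
  have hlen := hcyc _ _ hcycle
  rw [SimpleGraph.Walk.length_cons, SimpleGraph.Walk.length_map] at hlen
  have := height_abs_sub_le_length F p
  rw [abs_sub_comm]
  omega

theorem exists_lift_adj {H : SimpleGraph V} (hHG : H ≤ G)
    (hcyc : ∀ (v : V) (c : G.Walk v v), c.IsCycle → c.length < N)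
    (f : G →g unitStepGraph (ZMod N)) (F : H →g unitStepGraph ℤ)
    (hF : ∀ v, (F v : ZMod N) = f v) {a b : V} (hab : G.Adj a b) (hnab : ¬ H.Adj a b) :
    ∃ F' : H →g unitStepGraph ℤ, (∀ v, (F' v : ZMod N) = f v) ∧
      (unitStepGraph ℤ).Adj (F' a) (F' b) := by
  classical
  have hcast : (unitStepGraph (ZMod N)).Adj (F a) (F b) := by
    simpa only [hF] using f.map_adj hab
  by_cases hr : H.Reachable b a
  · exact ⟨F, hF, adj_of_cast_adj hcast (abs_sub_add_one_lt_of_reachable hHG hcyc F hab hnab hr)⟩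
  · obtain ⟨d, hd, hadj⟩ := exists_shift_adj_of_cast_adj hcast
    have hne : H.connectedComponentMk a ≠ H.connectedComponentMk b := fun h =>
      hr (SimpleGraph.ConnectedComponent.eq.1 h).symm
    refine ⟨shiftComponents F (Pi.single (H.connectedComponentMk b) d), fun v => ?_, ?_⟩
    · rw [← hF v, ZMod.intCast_eq_intCast_iff_dvd_sub, ← dvd_neg]
      by_cases hv : H.connectedComponentMk v = H.connectedComponentMk b <;>
        simp [shiftComponents, hv, hd]
    · simpa [shiftComponents, hne] using hadj

/-- The sum of the steps along a cycle is a multiple of `N`, of absolute value at most the length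
of the cycle, so it vanishes. -/
theorem exists_height_lift [Finite V] (f : G →g unitStepGraph (ZMod N))
    (hcyc : ∀ (v : V) (c : G.Walk v v), c.IsCycle → c.length < N) :
    ∃ F : G →g unitStepGraph ℤ, ∀ v, (F v : ZMod N) = f v := by
  induction G using WellFoundedLT.induction with
  | ind G ih =>
  by_cases hG : ∃ a b, G.Adj a b
  · obtain ⟨a, b, hab⟩ := hG
    let H := G.deleteEdges {s(a, b)}
    have hHG : H ≤ G := G.deleteEdges_le _
    have hnab : ¬ H.Adj a b := by simp [H]
    obtain ⟨F, hF⟩ := ih H (lt_of_le_not_ge hHG fun h => hnab (h hab))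
      (f.comp (SimpleGraph.Hom.ofLE hHG)) fun v c hc => by
        simpa using hcyc v (c.mapLe hHG) (hc.mapLe hHG)
    obtain ⟨F', hF', hadj⟩ := exists_lift_adj hHG hcyc f F hF hab hnab
    refine ⟨⟨F', fun {x y} hxy => ?_⟩, hF'⟩
    by_cases hxy' : s(x, y) = s(a, b)
    · rcases Sym2.eq_iff.1 hxy' with ⟨rfl, rfl⟩ | ⟨rfl, rfl⟩
      exacts [hadj, hadj.symm]
    · exact F'.map_adj (SimpleGraph.deleteEdges_adj.2 ⟨hxy, hxy'⟩)
  · choose F hF using fun v => ZMod.intCast_surjective (f v)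
    exact ⟨⟨F, fun {x y} hxy => (hG ⟨x, y, hxy⟩).elim⟩, hF⟩

end Lifting

section Flattening

variable {V : Type*} [Finite V] {G : SimpleGraph V}

theorem exists_local_max_of_lt {E F : G →g unitStepGraph ℤ} (hpar : ∀ v, F v ≡ E v [ZMOD 2])
    (hlt : ∃ v, E v < F v) : ∃ v, E v + 2 ≤ F v ∧ ∀ u, G.Adj v u → F u = F v - 1 := by
  obtain ⟨v, hv, hmax⟩ := Set.exists_max_image {v | E v < F v} F (Set.toFinite _) hlt
  simp only [Set.mem_ofPred_eq, Int.ModEq] at hv hmax hpar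
  refine ⟨v, by have := hpar v; omega, fun u huv => ?_⟩
  have hFu := unitStepGraph_adj.1 (F.map_adj huv)
  have hEu := unitStepGraph_adj.1 (E.map_adj huv)
  have := hmax u
  omega

/-- Wherever one height function exceeds the other, it can be lowered by `2` at its highest such
vertex, which decreases the distance between the two. -/
theorem height_reachable_of_modEq (E F : G →g unitStepGraph ℤ)
    (hpar : ∀ v, F v ≡ E v [ZMOD 2]) : (colGraph G (unitStepGraph ℤ)).Reachable F E := by
  classical
  have := Fintype.ofFinite V
  induction hs : ∑ v, (F v - E v).natAbs using Nat.strong_induction_on generalizing E F with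
  | _ s ih =>
  by_cases heq : F = E
  · exact heq ▸ .rfl
  wlog hlt : ∃ v, E v < F v generalizing E F
  · obtain ⟨v, hv⟩ := DFunLike.ne_iff.1 heq
    refine (this F E (fun w => (hpar w).symm) ?_ (Ne.symm heq) ?_).symm
    · exact hs ▸ Finset.sum_congr rfl fun w _ => by omega
    · exact ⟨v, lt_of_le_of_ne (not_lt.1 fun h => hlt ⟨v, h⟩) hv⟩
  obtain ⟨v, hv, hadj⟩ := exists_local_max_of_lt hpar hlt
  let F' := recolor F v (F v - 2) fun u hu => unitStepGraph_adj.2 (by rw [hadj u hu]; omega)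
  have hF'v : F' v = F v - 2 := recolor_self F v _ _
  have hF' : ∀ w, w ≠ v → F' w = F w := fun w hw => recolor_of_ne F _ _ hw
  refine (colGraph_reachable_recolor F v _ _).trans (ih _ ?_ E F' (fun w => ?_) rfl)
  · rw [← hs]
    refine Finset.sum_lt_sum (fun w _ => ?_) ⟨v, Finset.mem_univ v, by omega⟩
    rcases eq_or_ne w v with rfl | hw
    · omega
    · rw [hF' w hw]
  · rcases eq_or_ne w v with rfl | hw
    · rw [hF'v]
      exact (Int.sub_modulus_modEq_iff).2 (hpar w)
    · rw [hF' w hw]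
      exact hpar w

end Flattening

section OddCycle

variable {V : Type*} {G : SimpleGraph V} {n : ℕ}

theorem zmod_two_sub_eq_one {x y : ZMod 2} (h : x - y = 1 ∨ y - x = 1) :
    x - y = 1 ∧ y - x = 1 := by
  decide +revert

/-- For odd `n`, the bipartite double cover of the `n`-cycle is the `2n`-cycle. -/
theorem exists_lift_double_cover (hn : Odd n) (hn1 : 1 < n) (F₀ : G →g unitStepGraph ℤ)
    (f : G →g unitStepGraph (ZMod n)) :
    ∃ f' : G →g unitStepGraph (ZMod (n * 2)), ∀ (v : V) (m : ℤ), (m : ZMod (n * 2)) = f' v →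
      (m : ZMod n) = f v ∧ m ≡ F₀ v [ZMOD 2] := by
  have : Fact (1 < n) := ⟨hn1⟩
  have : Fact (1 < n * 2) := ⟨by omega⟩
  let e := ZMod.chineseRemainder hn.coprime_two_right
  let parity : G →g unitStepGraph (ZMod 2) := (unitStepMap (Int.castRingHom (ZMod 2))).comp F₀
  let pair : G →g unitStepGraph (ZMod n × ZMod 2) :=
    ⟨fun v => (f v, parity v), fun {u v} huv => by
      obtain ⟨huv₂, hvu₂⟩ := zmod_two_sub_eq_one (unitStepGraph_adj.1 (parity.map_adj huv))
      exact unitStepGraph_adj.2 ((unitStepGraph_adj.1 (f.map_adj huv)).imp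
        (fun h => Prod.ext h huv₂) fun h => Prod.ext h hvu₂)⟩
  refine ⟨(unitStepMap (e.symm : ZMod n × ZMod 2 →+* ZMod (n * 2))).comp pair, fun v m hm => ?_⟩
  have hpair : ((m : ZMod n), (m : ZMod 2)) = (f v, (F₀ v : ZMod 2)) :=
    (map_intCast e m).symm.trans ((congrArg e hm).trans (e.apply_symm_apply _))
  exact ⟨congrArg Prod.fst hpair,
    (ZMod.intCast_eq_intCast_iff m (F₀ v) 2).1 (congrArg Prod.snd hpair)⟩

theorem isMixing_unitStepGraph [Finite V] (hG : G.IsBipartite) (hn : Odd n) (hn1 : 1 < n)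
    (hcyc : ∀ (v : V) (c : G.Walk v v), c.IsCycle → c.length < n * 2) :
    IsMixing G (unitStepGraph (ZMod n)) := by
  have : Fact (1 < n) := ⟨hn1⟩
  obtain ⟨F₀⟩ := isBipartite_iff_nonempty_height.1 hG
  let reduce : unitStepGraph ℤ →g unitStepGraph (ZMod n) := unitStepMap (Int.castRingHom (ZMod n))
  have hreach : ∀ f, (colGraph G (unitStepGraph (ZMod n))).Reachable f (reduce.comp F₀) := by
    intro f
    obtain ⟨f', hf'⟩ := exists_lift_double_cover hn hn1 F₀ f
    obtain ⟨F, hF⟩ := exists_height_lift f' hcyc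
    have hfF : reduce.comp F = f := RelHom.ext fun v => (hf' v _ (hF v)).1
    exact hfF ▸ colGraph_reachable_comp_left reduce
      (height_reachable_of_modEq F₀ F fun v => (hf' v _ (hF v)).2)
  have : Nonempty (G →g unitStepGraph (ZMod n)) := ⟨reduce.comp F₀⟩
  exact ⟨fun f g => (hreach f).trans (hreach g).symm⟩

theorem isMixing_cycleGraph [Finite V] (hG : G.IsBipartite) {k : ℕ} (hk : 1 ≤ k)
    (hcyc : ∀ (v : V) (c : G.Walk v v), c.IsCycle → c.length < 4 * k + 2) :
    IsMixing G (SimpleGraph.cycleGraph (2 * k + 1)) := by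
  rw [SimpleGraph.cycleGraph_eq_circulantGraph]
  exact isMixing_unitStepGraph hG (odd_two_mul_add_one k) (by omega) fun v c hc =>
    (hcyc v c hc).trans_eq (by ring)

theorem length_le_card_of_isCycle [Finite V] {v : V} {c : G.Walk v v} (hc : c.IsCycle) :
    c.length ≤ Nat.card V := by
  have := Fintype.ofFinite V
  have h := hc.support_nodup.length_le_card
  rwa [List.length_tail, SimpleGraph.Walk.length_support, Nat.add_sub_cancel,
    ← Nat.card_eq_fintype_card] at h

theorem isMixing_cycleGraph_of_card_lt [Finite V] (hG : G.IsBipartite) {k : ℕ} (hk : 1 ≤ k)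
    (hcard : Nat.card V < 4 * k + 2) : IsMixing G (SimpleGraph.cycleGraph (2 * k + 1)) :=
  isMixing_cycleGraph hG hk fun _ _ hc => (length_le_card_of_isCycle hc).trans_lt hcard

end OddCycle

section CircularClique

variable {p q k : ℕ}

theorem circularClique_adj_iff {u v : Fin p} : (circularClique p q).Adj u v ↔
    u ≠ v ∧ ((u : ℕ) + q ≤ v ∧ (v : ℕ) + q ≤ u + p ∨ (v : ℕ) + q ≤ u ∧ (u : ℕ) + q ≤ v + p) := by
  simp only [circularClique, le_abs, abs_le]
  omega

theorem circularClique_one (p : ℕ) : circularClique p 1 = ⊤ := by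
  ext u v
  rw [circularClique_adj_iff, SimpleGraph.top_adj, ne_eq, ← Fin.val_inj]
  omega

theorem two_mul_sub_two_mul_eq_one_iff (a b : ZMod (2 * k + 1)) :
    2 * a - 2 * b = 1 ↔ a.val = b.val + k + 1 ∨ b.val = a.val + k := by
  have ha := a.val_lt
  have hb := b.val_lt
  have hcast : ((2 * (a.val : ℤ) - 2 * b.val - 1 : ℤ) : ZMod (2 * k + 1)) = 2 * a - 2 * b - 1 := by
    push_cast
    rw [ZMod.natCast_zmod_val, ZMod.natCast_zmod_val]
  rw [← sub_eq_zero, ← hcast, ZMod.intCast_zmod_eq_zero_iff_dvd]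
  constructor
  · rintro ⟨t, ht⟩
    push_cast at ht
    have ht_lt : t < 2 := by by_contra!; nlinarith
    have ht_gt : -2 < t := by by_contra!; nlinarith
    interval_cases t <;> omega
  · rintro (h | h)
    · exact ⟨1, by push_cast; omega⟩
    · exact ⟨-1, by push_cast; omega⟩

/-- The isomorphism is doubling modulo `2 * k + 1`. -/
theorem nonempty_circularClique_iso_cycleGraph (hk : 1 ≤ k) :
    Nonempty (circularClique (2 * k + 1) k ≃g SimpleGraph.cycleGraph (2 * k + 1)) := by
  have hunit : IsUnit (2 : ZMod (2 * k + 1)) := by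
    have := (ZMod.isUnit_iff_coprime 2 (2 * k + 1)).2 (by simp)
    exact_mod_cast this
  have : Fact (1 < 2 * k + 1) := ⟨by omega⟩
  rw [SimpleGraph.cycleGraph_eq_circulantGraph]
  refine ⟨⟨(hunit.unit.mulLeft : ZMod (2 * k + 1) ≃ ZMod (2 * k + 1)), fun {x y} => ?_⟩⟩
  have := x.isLt
  refine unitStepGraph_adj.trans ((or_congr (two_mul_sub_two_mul_eq_one_iff x y)
    (two_mul_sub_two_mul_eq_one_iff y x)).trans (Iff.trans ?_ circularClique_adj_iff.symm))
  change (x.val = y.val + k + 1 ∨ y.val = x.val + k) ∨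
    (y.val = x.val + k + 1 ∨ x.val = y.val + k) ↔ _
  rw [ne_eq, ← Fin.val_inj]
  omega

theorem card_mul_le_of_hom {W : Type*} [Fintype W] (hqp : q ≤ p)
    (f : (⊤ : SimpleGraph W) →g circularClique p q) : Fintype.card W * q ≤ p := by
  rcases p.eq_zero_or_pos with rfl | hp
  · simp [Nat.le_zero.1 hqp]
  have : NeZero p := ⟨hp.ne'⟩
  let arc : W × Fin q → ZMod p := fun x => ((f x.1 : ℕ) : ZMod p) + ((x.2 : ℕ) : ZMod p)
  have harc : Function.Injective arc := by
    rintro ⟨a, i⟩ ⟨b, j⟩ h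
    have hi := i.isLt
    have hj := j.isLt
    have hb := (f b).isLt
    have hdvd : (p : ℤ) ∣ ((f a : ℤ) + i) - ((f b : ℤ) + j) := by
      rw [← ZMod.intCast_zmod_eq_zero_iff_dvd]
      push_cast
      exact sub_eq_zero.2 h
    have hab : a = b := by
      by_contra hab
      have hadj := circularClique_adj_iff.1 (f.map_adj ((SimpleGraph.top_adj a b).2 hab))
      have := Int.eq_zero_of_abs_lt_dvd hdvd (abs_lt.2 ⟨by omega, by omega⟩)
      omega
    subst hab
    have := Int.eq_zero_of_abs_lt_dvd hdvd (abs_lt.2 ⟨by omega, by omega⟩)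
    exact congrArg (Prod.mk a) (Fin.ext (by omega))
  simpa using Fintype.card_le_of_injective arc harc

end CircularClique

section Winding

variable {V : Type*} {G : SimpleGraph V} {p q : ℕ}

/-- The contribution of a step from `a` to `b` around the circle `0, …, p - 1` to the winding
number, when steps are taken in the increasing direction: `1` if the step passes `0`. -/
def descent (a b : Fin p) : ℤ := if b < a then 1 else 0

/-- The change of `descent · x` when the colour `a` is replaced by `b`. -/
def crossing (a b x : Fin p) : ℤ := descent b x - descent a x

theorem descent_add_swap {a b : Fin p} (hab : a ≠ b) : descent a b + descent b a = 1 := by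
  simp only [descent, Fin.lt_def]
  have := Fin.val_ne_of_ne hab
  split_ifs <;> omega

theorem descent_rev (a b : Fin p) : descent a.rev b.rev = descent b a := by
  simp only [descent, Fin.rev_lt_rev]

/-- The common neighbours of `a` and `b` lie on both arcs between `a` and `b` only if these arcs
have length at least `2 * q`. -/
theorem crossing_eq_or_adj {a b x y : Fin p} (hax : (circularClique p q).Adj a x)
    (hay : (circularClique p q).Adj a y) (hbx : (circularClique p q).Adj b x)
    (hby : (circularClique p q).Adj b y) :
    crossing a b x = crossing a b y ∨ (circularClique p q).Adj a b ∧ 4 * q ≤ p := by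
  rw [circularClique_adj_iff] at *
  simp only [ne_eq, ← Fin.val_inj] at *
  simp only [crossing, descent, Fin.lt_def]
  split_ifs <;> omega

/-- The step functions `descent` of the colourings `f` and `g` differ by a coboundary, so the
images of every closed walk under `f` and `g` have the same winding number. -/
def SameWinding (f g : G →g circularClique p q) : Prop :=
  ∃ t : V → ℤ, ∀ x y, G.Adj x y → descent (g x) (g y) = descent (f x) (f y) + (t y - t x)

theorem SameWinding.refl (f : G →g circularClique p q) : SameWinding f f :=
  ⟨0, by simp⟩

theorem SameWinding.trans {f g h : G →g circularClique p q} (hfg : SameWinding f g)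
    (hgh : SameWinding g h) : SameWinding f h := by
  obtain ⟨s, hs⟩ := hfg
  obtain ⟨t, ht⟩ := hgh
  refine ⟨s + t, fun x y hxy => ?_⟩
  rw [ht x y hxy, hs x y hxy, Pi.add_apply, Pi.add_apply]
  ring

theorem sameWinding_of_crossing_eq {f g : G →g circularClique p q} {v : V} {e : ℤ}
    (hfg : ∀ w, w ≠ v → f w = g w) (he : ∀ x, G.Adj v x → crossing (f v) (g v) (f x) = e) :
    SameWinding f g := by
  classical
  have hdescent : ∀ x, G.Adj v x → descent (g v) (g x) = descent (f v) (f x) + e := by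
    intro x hx
    rw [← he x hx, crossing, ← hfg x hx.ne']
    ring
  refine ⟨Pi.single v (-e), fun x y hxy => ?_⟩
  rcases eq_or_ne x v with rfl | hx
  · rw [hdescent y hxy, Pi.single_eq_same, Pi.single_eq_of_ne hxy.ne']
    ring
  rcases eq_or_ne y v with rfl | hy
  · rw [Pi.single_eq_same, Pi.single_eq_of_ne hx]
    linarith [hdescent x hxy.symm, descent_add_swap (f.map_adj hxy).ne,
      descent_add_swap (g.map_adj hxy).ne]
  · rw [Pi.single_eq_of_ne hx, Pi.single_eq_of_ne hy, hfg x hx, hfg y hy]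
    ring

/-- The reflection of the circle, which reverses winding numbers. -/
def circularCliqueRev (p q : ℕ) : circularClique p q →g circularClique p q where
  toFun := Fin.rev
  map_rel' {a b} h := by
    rw [circularClique_adj_iff] at h ⊢
    rw [ne_eq, Fin.rev_inj, Fin.val_rev, Fin.val_rev]
    omega

/-- The coboundary between `f` and its reflection has odd values `1 - 2 * descent (f x) (f y)`, so
it comes from a height function. -/
theorem isBipartite_of_sameWinding_rev {f : G →g circularClique p q}
    (h : SameWinding f ((circularCliqueRev p q).comp f)) : G.IsBipartite := by
  obtain ⟨t, ht⟩ := h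
  refine isBipartite_iff_nonempty_height.2 ⟨⟨t, fun {x y} hxy => unitStepGraph_adj.2 ?_⟩⟩
  have hrev : descent (f y) (f x) = descent (f x) (f y) + (t y - t x) :=
    (descent_rev (f x) (f y)).symm.trans (ht x y hxy)
  have hswap := descent_add_swap (f.map_adj hxy).ne
  have hdescent : descent (f x) (f y) = 0 ∨ descent (f x) (f y) = 1 := by
    unfold descent
    split_ifs <;> simp
  omega

theorem isBipartite_of_reachable_rev {f : G →g circularClique p q}
    (hcross : ∀ (f g : G →g circularClique p q) (v : V), (∀ w, w ≠ v → f w = g w) →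
      ∀ x y, G.Adj v x → G.Adj v y → crossing (f v) (g v) (f x) = crossing (f v) (g v) (f y))
    (h : (colGraph G (circularClique p q)).Reachable f ((circularCliqueRev p q).comp f)) :
    G.IsBipartite := by
  refine isBipartite_of_sameWinding_rev
    (rel_of_colGraph_reachable SameWinding.refl (fun _ _ _ => .trans) (fun f g v hfg => ?_) h)
  by_cases hv : ∃ x, G.Adj v x
  · obtain ⟨x, hx⟩ := hv
    exact sameWinding_of_crossing_eq hfg fun y hy => hcross f g v hfg y x hy hx
  · exact sameWinding_of_crossing_eq (e := 0) hfg fun y hy => (hv ⟨y, hy⟩).elim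

theorem crossing_eq_or_adj_of_eq_off {f g : G →g circularClique p q} {v x y : V}
    (hfg : ∀ w, w ≠ v → f w = g w) (hx : G.Adj v x) (hy : G.Adj v y) :
    crossing (f v) (g v) (f x) = crossing (f v) (g v) (f y) ∨
      (circularClique p q).Adj (f v) (g v) ∧ 4 * q ≤ p :=
  crossing_eq_or_adj (f.map_adj hx) (f.map_adj hy) (hfg x hx.ne' ▸ g.map_adj hx)
    (hfg y hy.ne' ▸ g.map_adj hy)

theorem isBipartite_of_isMixing_of_lt (hpq : p < 4 * q) (hmix : IsMixing G (circularClique p q)) :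
    G.IsBipartite := by
  obtain ⟨f⟩ := hmix.nonempty
  exact isBipartite_of_reachable_rev (fun _ _ _ hfg _ _ hx hy =>
    (crossing_eq_or_adj_of_eq_off hfg hx hy).resolve_right fun h => hpq.not_ge h.2)
    (hmix.preconnected f _)

end Winding

section Clique

variable {V W : Type*} [Fintype W] {G : SimpleGraph V} {p q : ℕ}

theorem not_adj_of_eq_off (hqp : q ≤ p) (hpq : p < (Fintype.card W + 1) * q)
    {f g : (⊤ : SimpleGraph W) →g circularClique p q} {v : W} (hfg : ∀ w, w ≠ v → f w = g w) :
    ¬ (circularClique p q).Adj (f v) (g v) := by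
  intro hadj
  have hg : ∀ w, (circularClique p q).Adj (g v) (f w) := by
    intro w
    rcases eq_or_ne w v with rfl | hw
    · exact hadj.symm
    · exact hfg w hw ▸ g.map_adj hw.symm
  let h : (⊤ : SimpleGraph (Option W)) →g circularClique p q :=
    ⟨fun w => w.elim (g v) f, fun {x y} hxy => by
      rcases x with _ | x <;> rcases y with _ | y
      exacts [(hxy rfl).elim, hg y, (hg x).symm, f.map_adj fun h => hxy (congrArg some h)]⟩
  have := card_mul_le_of_hom hqp h
  rw [Fintype.card_option] at this
  exact hpq.not_ge this

theorem card_succ_mul_le_of_isMixing (hW : 3 ≤ Fintype.card W) (φ : (⊤ : SimpleGraph W) ↪g G)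
    (hqp : q ≤ p) (hmix : IsMixing G (circularClique p q)) : (Fintype.card W + 1) * q ≤ p := by
  by_contra! hpq
  obtain ⟨f⟩ := hmix.nonempty
  have hbip : (⊤ : SimpleGraph W).IsBipartite :=
    isBipartite_of_reachable_rev (f := f.comp φ.toHom) (fun _ _ _ hfg _ _ hx hy =>
      (crossing_eq_or_adj_of_eq_off hfg hx hy).resolve_right
        fun h => not_adj_of_eq_off hqp hpq hfg h.1)
      (colGraph_reachable_comp_right φ (hmix.preconnected f ((circularCliqueRev p q).comp f)))
  have hcard : Fintype.card W ≤ 2 := by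
    have := SimpleGraph.IsClique.card_le_of_colorable (s := Finset.univ) (by simp) hbip
    rwa [Finset.card_univ] at this
  omega

end Clique

section CompleteGraph

variable {V W : Type*} [Fintype V] [Fintype W] (G : SimpleGraph V)

theorem exists_hom_top_forall_notMem (used : Finset W)
    (hcard : used.card + Fintype.card V ≤ Fintype.card W) :
    ∃ h : G →g (⊤ : SimpleGraph W), ∀ v, h v ∉ used := by
  classical
  obtain ⟨h, hh⟩ := Function.Embedding.exists_of_card_le_finset (α := V) (s := usedᶜ)
    (by rw [Finset.card_compl]; omega)
  exact ⟨⟨h, fun huv => h.injective.ne huv.ne⟩, fun v => by simpa using hh ⟨v, rfl⟩⟩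

/-- Two colourings are joined through one that uses none of their colours. -/
theorem isMixing_top_of_card_le (hcard : 3 * Fintype.card V ≤ Fintype.card W) :
    IsMixing G (⊤ : SimpleGraph W) := by
  classical
  obtain ⟨f₀, -⟩ := exists_hom_top_forall_notMem G (∅ : Finset W)
    (by rw [Finset.card_empty]; omega)
  have : Nonempty (G →g (⊤ : SimpleGraph W)) := ⟨f₀⟩
  refine ⟨fun f g => ?_⟩
  let used := Finset.univ.image f ∪ Finset.univ.image g
  have hused : used.card ≤ Fintype.card V + Fintype.card V :=
    (Finset.card_union_le _ _).trans (add_le_add Finset.card_image_le Finset.card_image_le)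
  obtain ⟨h, hh⟩ := exists_hom_top_forall_notMem G used (by omega)
  have hf (u v : V) : f u ≠ h v := fun huv => hh v (by simp [used, ← huv])
  have hg (u v : V) : g u ≠ h v := fun huv => hh v (by simp [used, ← huv])
  exact (colGraph_reachable_of_forall_adj fun u v _ => hf u v).trans
    (colGraph_reachable_of_forall_adj fun u v _ => hg u v).symm

end CompleteGraph

section CircularMixingNumber

variable {V : Type*} {G : SimpleGraph V} {p q : ℕ}

theorem two_le_div (hq : 0 < q) (hpq : 2 * q ≤ p) : (2 : ℝ) ≤ p / q := by
  rw [le_div_iff₀ (by exact_mod_cast hq)]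
  exact_mod_cast hpq

theorem circularMixingNumber_le (hq : 0 < q) (hpq : 2 * q ≤ p)
    (hmix : IsMixing G (circularClique p q)) : circularMixingNumber G ≤ p / q := by
  refine csInf_le ⟨2, ?_⟩ ⟨p, q, hq, hpq, hmix, rfl⟩
  rintro _ ⟨p, q, hq, hpq, -, rfl⟩
  exact two_le_div hq hpq

theorem le_circularMixingNumber [Finite V] {r : ℝ} (h : ∀ p q : ℕ, 0 < q → 2 * q ≤ p →
    IsMixing G (circularClique p q) → r ≤ p / q) : r ≤ circularMixingNumber G := by
  have := Fintype.ofFinite V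
  have hmix : IsMixing G (circularClique (3 * Fintype.card V + 2) 1) := by
    rw [circularClique_one]
    exact isMixing_top_of_card_le G (by rw [Fintype.card_fin]; omega)
  refine le_csInf ⟨_, _, 1, one_pos, by omega, hmix, rfl⟩ ?_
  rintro _ ⟨p, q, hq, hpq, hmix, rfl⟩
  exact h p q hq hpq hmix

theorem circularMixingNumber_eq_two [Finite V] (hG : G.IsBipartite) :
    circularMixingNumber G = 2 := by
  refine le_antisymm ?_ (le_circularMixingNumber fun _ _ hq hpq _ => two_le_div hq hpq)
  have hlim : Filter.Tendsto (fun k : ℕ => (2 : ℝ) + 1 / k) Filter.atTop (nhds 2) := by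
    simpa using tendsto_const_nhds.add (tendsto_one_div_atTop_nhds_zero_nat (𝕜 := ℝ))
  refine ge_of_tendsto hlim (Filter.eventually_atTop.2 ⟨Nat.card V + 1, fun k hk => ?_⟩)
  have hk0 : 0 < k := by omega
  obtain ⟨e⟩ := nonempty_circularClique_iso_cycleGraph hk0
  refine (circularMixingNumber_le hk0 (by omega) (isMixing_of_iso e.symm
    (isMixing_cycleGraph_of_card_lt hG hk0 (by omega)))).trans_eq ?_
  push_cast
  field_simp

theorem max_le_circularMixingNumber [Finite V] (hG : ¬ G.IsBipartite) :
    max 4 ((G.cliqueNum : ℝ) + 1) ≤ circularMixingNumber G := by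
  refine le_circularMixingNumber fun p q hq _ hmix => ?_
  have hfour : 4 * q ≤ p := not_lt.1 fun h => hG (isBipartite_of_isMixing_of_lt h hmix)
  have hclique : (G.cliqueNum + 1) * q ≤ p := by
    by_cases hω : 3 ≤ G.cliqueNum
    · obtain ⟨S, hS⟩ := G.exists_isNClique_cliqueNum
      simpa using card_succ_mul_le_of_isMixing (by simpa using hω)
        (SimpleGraph.topEmbeddingOfNotCliqueFree hS.not_cliqueFree) (by omega) hmix
    · nlinarith
  rw [max_le_iff, le_div_iff₀ (by exact_mod_cast hq), le_div_iff₀ (by exact_mod_cast hq)]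
  exact ⟨by exact_mod_cast hfour, by exact_mod_cast hclique⟩

end CircularMixingNumber

theorem theorem2p5 {V : Type*} [Finite V] (G : SimpleGraph V) :
    (G.IsBipartite →
      (∃ k : ℕ, 1 ≤ k ∧ IsMixing G (SimpleGraph.cycleGraph (2 * k + 1))) ∧
      (∃ k₀ : ℕ, ∀ k : ℕ, k₀ ≤ k → IsMixing G (SimpleGraph.cycleGraph (2 * k + 1))) ∧
      (∀ k : ℕ, 1 ≤ k →
        (∀ (v : V) (c : G.Walk v v), c.IsCycle → c.length < 4 * k + 2) →
        IsMixing G (SimpleGraph.cycleGraph (2 * k + 1))) ∧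
      circularMixingNumber G = 2) ∧
    (¬ G.IsBipartite →
      max 4 ((G.cliqueNum : ℝ) + 1) ≤ circularMixingNumber G) := by
  refine ⟨fun hG => ?_, max_le_circularMixingNumber⟩
  have hlarge : ∀ k, Nat.card V + 1 ≤ k → IsMixing G (SimpleGraph.cycleGraph (2 * k + 1)) :=
    fun k hk => isMixing_cycleGraph_of_card_lt hG (by omega) (by omega)
  exact ⟨⟨Nat.card V + 1, by omega, hlarge _ le_rfl⟩, ⟨_, hlarge⟩,
    fun _ hk hcyc => isMixing_cycleGraph hG hk hcyc, circularMixingNumber_eq_two hG⟩
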